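/- For $\mu\in\mathbb{C}$ let $F_\mu$ be the Fock module with highest weight vector $|\mu\rangle$ over the Heisenberg Lie algebra $\langle C, a_n : n\in\mathbb{Z}\rangle_{\mathbb{C}}$, $[a_n,a_m]=n\,\delta_{n+m,0}\,C$, $C$ central, with $C=1$, $a_0|\mu\rangle=\mu|\mu\rangle$ and $a_n|\mu\rangle=0$ for $n>0$. For an integer $M\ge 1$ put $V_{\sqrt{M}\mathbb{Z}}=\bigoplus_{j\in\mathbb{Z}}F_{j\sqrt{M}}$, and for $\eta\in\sqrt{M}\mathbb{Z}$ let $$V_{\eta}(z)=e^{\eta q}\,z^{\eta a_0}\,\exp\Big(-\eta\sum_{n<0}\frac{a_n}{n}z^{-n}\Big)\exp\Big(-\eta\sum_{n>0}\frac{a_n}{n}z^{-n}\Big)$$ be the vertex operator of $|\eta\rangle$ on $V_{\sqrt{M}\mathbb{Z}}$, where $e^{\eta q}:F_\lambda\to F_{\lambda+\eta}$ maps $|\lambda\rangle$ to $|\lambda+\eta\rangle$ and commutes with all $a_n$, $n\neq 0$. Theorem. 1. (Even case) Let $N\ge 1$ and $M=2N$. Write $V_{\sqrt{2N}}(z)=\sum_{n\in\mathbb{Z}}e_n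 z^{-n-N}$ and, for $j\in\mathbb{Z}$, let $W_j^{\sqrt{2N}}=\mathbb{C}[e_i \mid i\in\mathbb{Z}]\,|j\sqrt{2N}\rangle\subset V_{\sqrt{2N}\mathbb{Z}}$ be the space of all vectors obtained by applying polynomials in the (commuting) operators $e_i$ to $|j\sqrt{2N}\rangle$. Then $W^{\sqrt{2N}}=\bigcup_{j\in\mathbb{Z}}W_j^{\sqrt{2N}}$ is invariant under $a_n$ for every $n\in\mathbb{Z}$, and $W^{\sqrt{2N}}=V_{\sqrt{2N}\mathbb{Z}}$. 2. (Odd case) Let $N\ge 0$ and $M=2N+1$. Write $V_{\sqrt{2N+1}}(z)=\sum_{n\in\mathbb{Z}}\theta_n z^{-n}$ and, for $j\in\mathbb{Z}$, let $W_j^{\sqrt{2N+1}}=\mathbb{C}\{\theta_i \mid i\in\mathbb{Z}\}\,|j\sqrt{2N+1}\rangle\subset V_{\sqrt{2N+1}\mathbb{Z}}$ be the space of all vectors obtained by applying polynomials in the (anticommuting) operators $\theta_i$ to $|j\sqrt{2N+1}\rangle$. Then $W^{\sqrt{2N+1}}=\bigcup_{j\in\mathbb{Z}}W_j^{\sqrt{2N+1}}$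 is invariant under $a_n$ for every $n\in\mathbb{Z}$, and $W^{\sqrt{2N+1}}=V_{\sqrt{2N+1}\mathbb{Z}}$. -/

import Mathlib

open scoped PowerSeries

noncomputable section

namespace LatticeVOA

/-- The Fock space of the Heisenberg algebra (spanned by `C` and `a_n`, with
`[a_n, a_m] = n δ_{n+m,0} C` and `C` acting as `1`), in its polynomial realization: the variable
`X k` stands for the creation operator `a_{-(k+1)}`, and `1` is the highest weight vector. -/
abbrev FockSpace : Type := MvPolynomial ℕ ℂ

/-- The mode `a_n` on the Fock module `F_μ`: multiplication by `X (k)` if `n = -(k+1)`, the scalar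
`μ` if `n = 0`, and `n ∂/∂X (k)` if `n = k+1`. -/
def fockMode (μ : ℂ) : ℤ → Module.End ℂ FockSpace
  | .ofNat 0 => μ • 1
  | .ofNat (k + 1) => ((k + 1 : ℕ) : ℂ) • (MvPolynomial.pderiv k).toLinearMap
  | .negSucc k => LinearMap.mulLeft ℂ (MvPolynomial.X k)

/-- `exp f = ∑_r f^r / r!` for a formal power series `f` without constant term, over a possibly
noncommutative algebra. (The `n`-th coefficient of `f ^ r` vanishes for `r > n`.) -/
def expSeries {A : Type*} [Ring A] [Algebra ℂ A] (f : A⟦X⟧) : A⟦X⟧ :=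
  PowerSeries.mk fun n =>
    ∑ r ∈ Finset.range (n + 1), ((r.factorial : ℂ)⁻¹) • PowerSeries.coeff n (f ^ r)

/-- `-η ∑_{n<0} (a_n / n) z^{-n}`, a power series in `X = z`.
(The modes `a_n` with `n ≠ 0` are the same on all the `F_μ`, so they are taken on `F_0`.) -/
def creationSeries (η : ℂ) : (Module.End ℂ FockSpace)⟦X⟧ :=
  PowerSeries.mk fun k => if k = 0 then 0 else (η / (k : ℂ)) • fockMode 0 (-(k : ℤ))

/-- `-η ∑_{n>0} (a_n / n) z^{-n}`, a power series in `X = z⁻¹`. -/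
def annihilationSeries (η : ℂ) : (Module.End ℂ FockSpace)⟦X⟧ :=
  PowerSeries.mk fun k => if k = 0 then 0 else (-(η / (k : ℂ))) • fockMode 0 (k : ℤ)

/-- The vectors of the Fock space of weight at most `w`, where `X k` has weight `k + 1`. -/
def weightLE (w : ℤ) : Submodule ℂ FockSpace :=
  MvPolynomial.restrictSupport ℂ {m | (Finsupp.weight (fun k : ℕ => k + 1) m : ℤ) ≤ w}

theorem weightLE_neg {w : ℤ} (h : w < 0) {v : FockSpace} (hv : v ∈ weightLE w) : v = 0 := by
  rw [← MvPolynomial.support_eq_empty, Finset.eq_empty_iff_forall_notMem]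
  intro m hm
  have h1 := (MvPolynomial.mem_restrictSupport_iff ℂ).1 hv hm
  simp only [Set.mem_ofPred_eq] at h1
  omega

theorem exists_weightLE (v : FockSpace) : ∃ w : ℕ, v ∈ weightLE w := by
  refine ⟨v.support.sup (Finsupp.weight fun k : ℕ => k + 1), ?_⟩
  refine (MvPolynomial.mem_restrictSupport_iff ℂ).2 fun m hm => ?_
  simp only [Set.mem_ofPred_eq, Nat.cast_le]
  exact Finset.le_sup (f := Finsupp.weight fun k : ℕ => k + 1) hm

theorem pderiv_weightLE (k : ℕ) (w : ℤ) {v : FockSpace} (hv : v ∈ weightLE w) :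
    MvPolynomial.pderiv k v ∈ weightLE (w - (k + 1)) := by
  rw [weightLE, MvPolynomial.restrictSupport_eq_span] at hv
  induction hv using Submodule.span_induction with
  | mem x hx =>
    obtain ⟨m, hm, rfl⟩ := hx
    simp only [Set.mem_ofPred_eq] at hm
    rw [MvPolynomial.pderiv_monomial, weightLE, MvPolynomial.monomial_mem_restrictSupport]
    by_cases h0 : m k = 0
    · right
      simp [h0]
    · left
      have hle : Finsupp.single k 1 ≤ m := by
        rw [Finsupp.single_le_iff]
        omega
      have h1 := congrArg (Finsupp.weight fun k : ℕ => k + 1) (tsub_add_cancel_of_le hle)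
      rw [map_add, Finsupp.weight_single] at h1
      simp only [smul_eq_mul, one_mul] at h1
      simp only [Set.mem_ofPred_eq]
      omega
  | zero => simp
  | add x y _ _ hx hy =>
    rw [map_add]
    exact Submodule.add_mem _ hx hy
  | smul c x _ hx =>
    rw [Derivation.map_smul]
    exact Submodule.smul_mem _ c hx

/-- The coefficient of `X ^ l` lowers the weight by at least `l`. -/
def LowersWeight (f : (Module.End ℂ FockSpace)⟦X⟧) : Prop :=
  ∀ (l : ℕ) (w : ℤ) (v : FockSpace), v ∈ weightLE w → PowerSeries.coeff l f v ∈ weightLE (w - l)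

theorem lowersWeight_annihilationSeries (η : ℂ) : LowersWeight (annihilationSeries η) := by
  intro l w v hv
  rw [annihilationSeries, PowerSeries.coeff_mk]
  cases l with
  | zero => simp
  | succ k =>
    rw [if_neg (Nat.succ_ne_zero k)]
    refine Submodule.smul_mem _ _ ?_
    have h := pderiv_weightLE k w hv
    rw [Nat.cast_succ]
    exact Submodule.smul_mem _ ((k + 1 : ℕ) : ℂ) h

theorem LowersWeight.pow {f : (Module.End ℂ FockSpace)⟦X⟧} (hf : LowersWeight f) (r : ℕ) :
    LowersWeight (f ^ r) := by
  induction r with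
  | zero =>
    intro l w v hv
    rw [pow_zero, PowerSeries.coeff_one]
    split_ifs with h
    · simpa [h] using hv
    · simp
  | succ r ih =>
    intro l w v hv
    rw [pow_succ, PowerSeries.coeff_mul, LinearMap.sum_apply]
    refine Submodule.sum_mem _ fun q hq => ?_
    have h := ih q.1 _ _ (hf q.2 w v hv)
    rw [Finset.HasAntidiagonal.mem_antidiagonal] at hq
    rw [Module.End.mul_apply]
    have h2 : w - (l : ℤ) = w - q.2 - q.1 := by omega
    rw [h2]
    exact h

theorem annihilationExp_weightLE (η : ℂ) (l : ℕ) (w : ℤ) {v : FockSpace} (hv : v ∈ weightLE w) :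
    PowerSeries.coeff l (expSeries (annihilationSeries η)) v ∈ weightLE (w - l) := by
  rw [expSeries, PowerSeries.coeff_mk, LinearMap.sum_apply]
  exact Submodule.sum_mem _ fun r _ =>
    Submodule.smul_mem _ _ ((lowersWeight_annihilationSeries η).pow r l w v hv)

theorem annihilationExp_eventually_zero (η : ℂ) (v : FockSpace) :
    ∃ L : ℕ, ∀ l : ℕ, L ≤ l → PowerSeries.coeff l (expSeries (annihilationSeries η)) v = 0 := by
  obtain ⟨w, hw⟩ := exists_weightLE v
  refine ⟨w + 1, fun l hl => weightLE_neg ?_ (annihilationExp_weightLE η l w hw)⟩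
  omega

/-- The term of index `l` in the coefficient of `z^p` in
`exp(-η ∑_{n<0} (a_n/n) z^{-n}) exp(-η ∑_{n>0} (a_n/n) z^{-n})`: the coefficient of `z^{p+l}` in the
first factor times the coefficient of `z^{-l}` in the second one. -/
def expTerm (η : ℂ) (p : ℤ) (l : ℕ) : Module.End ℂ FockSpace :=
  if 0 ≤ p + l then
    PowerSeries.coeff (p + l).toNat (expSeries (creationSeries η)) *
      PowerSeries.coeff l (expSeries (annihilationSeries η))
  else 0

theorem expTerm_support_finite (η : ℂ) (p : ℤ) (v : FockSpace) :
    (Function.support fun l => expTerm η p l v).Finite := by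
  obtain ⟨L, hL⟩ := annihilationExp_eventually_zero η v
  refine (Set.finite_lt_nat L).subset fun l hl => ?_
  by_contra h
  refine hl ?_
  simp only [expTerm]
  split_ifs
  · rw [Module.End.mul_apply, hL l (not_lt.1 h), map_zero]
  · rfl

/-- The coefficient of `z^p` in
`exp(-η ∑_{n<0} (a_n/n) z^{-n}) exp(-η ∑_{n>0} (a_n/n) z^{-n})`, an operator on the Fock space: on
each vector, only finitely many terms of the sum are nonzero. -/
def expCoeff (η : ℂ) (p : ℤ) : Module.End ℂ FockSpace where
  toFun v := ∑ᶠ l : ℕ, expTerm η p l v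
  map_add' u v := by
    simp only [map_add]
    exact finsum_add_distrib (expTerm_support_finite η p u) (expTerm_support_finite η p v)
  map_smul' c v := by
    simp only [map_smul, RingHom.id_apply]
    exact (smul_finsum c _).symm

theorem expCoeff_bddBelow (η : ℂ) (v : FockSpace) :
    BddBelow (Function.support fun p => expCoeff η p v) := by
  obtain ⟨L, hL⟩ := annihilationExp_eventually_zero η v
  refine ⟨-(L : ℤ), fun p hp => ?_⟩
  by_contra h
  refine hp ?_
  change ∑ᶠ l : ℕ, expTerm η p l v = 0
  refine (finsum_congr fun l => ?_).trans finsum_zero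
  simp only [expTerm]
  split_ifs with h0
  · rw [Module.End.mul_apply, hL l (by omega), map_zero]
  · rfl

/-- The space `V_{√M ℤ} = ⨁_{j ∈ ℤ} F_{j√M}`; the component of index `j` is `F_{j√M}`. -/
abbrev LatticeSpace (_M : ℕ) : Type := ℤ →₀ FockSpace

/-- The highest weight vector `|j√M⟩` of `F_{j√M}`. -/
def vac (M : ℕ) (j : ℤ) : LatticeSpace M := Finsupp.single j 1

/-- The real number `j√M`, as a complex number. -/
def charge (M : ℕ) (j : ℤ) : ℂ := ((j * Real.sqrt M : ℝ) : ℂ)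

/-- The mode `a_n` of `a(z) = ∑_n a_n z^{-n-1}` on `V_{√M ℤ}`. -/
def a (M : ℕ) (n : ℤ) : Module.End ℂ (LatticeSpace M) :=
  Finsupp.lsum ℂ fun j => Finsupp.lsingle j ∘ₗ fockMode (charge M j) n

/-- The coefficient of `z^p` in the vertex operator of `|k√M⟩`. On `F_{j√M}`, with `η = k√M`, the
operator `e^{η q}` is the identification with `F_{(j+k)√M}`, and `z^{η a_0}` is the scalar
`z^{k j M}`. -/
def vertexCoeff (M : ℕ) (k : ℤ) (p : ℤ) : Module.End ℂ (LatticeSpace M) :=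
  Finsupp.lsum ℂ fun j => Finsupp.lsingle (j + k) ∘ₗ expCoeff (charge M k) (p - k * j * M)

theorem vertexCoeff_bddBelow (M : ℕ) (k : ℤ) (v : LatticeSpace M) :
    BddBelow (Function.support fun p => vertexCoeff M k p v) := by
  induction v using Finsupp.induction_linear with
  | zero => simp [Function.support]
  | add u v hu hv =>
    refine (hu.union hv).mono ?_
    simp only [map_add]
    exact Function.support_add _ _
  | single j x =>
    obtain ⟨b, hb⟩ := expCoeff_bddBelow (charge M k) x
    refine ⟨b + k * j * M, fun p hp => ?_⟩
    have h : p - k * j * M ∈ Function.support fun p => expCoeff (charge M k) p x := by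
      intro h0
      refine hp ?_
      have h1 : expCoeff (charge M k) (p - k * j * M) x = 0 := h0
      simp [vertexCoeff, h1]
    have := hb h
    linarith

/-- The vertex operator of `|η⟩`, `η = k√M`, on `V_{√M ℤ}`:
`V_η(z) = e^{η q} z^{η a_0} exp(-η ∑_{n<0} (a_n/n) z^{-n}) exp(-η ∑_{n>0} (a_n/n) z^{-n})`. -/
def V (M : ℕ) (k : ℤ) : VertexOperator ℂ (LatticeSpace M) :=
  VertexOperator.of_coeff (vertexCoeff M k) (vertexCoeff_bddBelow M k)

/-- The modes of `V_{√(2N)}(z) = e(z) = ∑_n e_n z^{-n-N}`. -/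
def e (N : ℕ) (n : ℤ) : Module.End ℂ (LatticeSpace (2 * N)) :=
  HVertexOperator.coeff (V (2 * N) 1) (-n - N)

/-- The modes of `V_{√(2N+1)}(z) = θ(z) = ∑_n θ_n z^{-n}`. -/
def θ (N : ℕ) (n : ℤ) : Module.End ℂ (LatticeSpace (2 * N + 1)) :=
  HVertexOperator.coeff (V (2 * N + 1) 1) (-n)

/-- The basic subspace `W_j^{√(2N)} = ℂ[e_i | i ∈ ℤ] |j√(2N)⟩`: all the vectors `P |j√(2N)⟩`, where
`P` runs over the polynomials in the operators `e_i`. -/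
def evenBasic (N : ℕ) (j : ℤ) : Submodule ℂ (LatticeSpace (2 * N)) :=
  (Subalgebra.toSubmodule (Algebra.adjoin ℂ (Set.range (e N)))).map
    (LinearMap.applyₗ (vac (2 * N) j))

/-- The basic subspace `W_j^{√(2N+1)} = ℂ{θ_i | i ∈ ℤ} |j√(2N+1)⟩`: all the vectors
`P |j√(2N+1)⟩`, where `P` runs over the polynomials in the (anticommuting) operators `θ_i`. -/
def oddBasic (N : ℕ) (j : ℤ) : Submodule ℂ (LatticeSpace (2 * N + 1)) :=
  (Subalgebra.toSubmodule (Algebra.adjoin ℂ (Set.range (θ N)))).map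
    (LinearMap.applyₗ (vac (2 * N + 1) j))

/-- `W^{√(2N)}`, the union of the basic subspaces. -/
def evenUnion (N : ℕ) : Set (LatticeSpace (2 * N)) :=
  ⋃ j : ℤ, (evenBasic N j : Set (LatticeSpace (2 * N)))

/-- `W^{√(2N+1)}`, the union of the basic subspaces. -/
def oddUnion (N : ℕ) : Set (LatticeSpace (2 * N + 1)) :=
  ⋃ j : ℤ, (oddBasic N j : Set (LatticeSpace (2 * N + 1)))

end LatticeVOA

end

namespace LatticeVOA

/-! Applying the mode of index `j * M` to |j√M⟩ gives |(j+1)√M⟩, so the basic subspaces decrease in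
`j`. Their union is thus a directed supremum W, a subspace stable under all modes of the vertex
operator. Let S be the set of Fock vectors whose copy in every F_{j√M} lies in W. Then S contains 1
and is stable under every `expCoeff η p`, η = √M ≠ 0.

Such an S is everything, by induction on weight (`eq_top_of_expCoeff_mem`). Let E_m be the
coefficients of the creation exponential. Modulo products of at least two creation operators,
E_{k+1} is (η/(k+1)) X_k, so X_k is recovered from the E_m by induction on k. Moreover `expCoeff η m
v` is E_m v plus E's applied to vectors of smaller weight. Hence W is the whole space, and
invariance under a_n is automatic. Commutation relations between the modes play no role. -/

/-! ### Weights and the creation series. -/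

theorem X_mul_weightLE (k : ℕ) {w : ℤ} {v : FockSpace} (hv : v ∈ weightLE w) :
    MvPolynomial.X k * v ∈ weightLE (w + (k + 1)) := by
  rw [weightLE, MvPolynomial.restrictSupport_eq_span] at hv
  induction hv using Submodule.span_induction with
  | mem x hx =>
    obtain ⟨m, hm, rfl⟩ := hx
    simp only [Set.mem_ofPred_eq] at hm
    rw [MvPolynomial.X, MvPolynomial.monomial_mul, weightLE,
      MvPolynomial.monomial_mem_restrictSupport]
    left
    simp only [Set.mem_ofPred_eq, map_add, Finsupp.weight_single, smul_eq_mul, one_mul]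
    push_cast
    linarith
  | zero => simp
  | add x y _ _ hx hy =>
    rw [mul_add]
    exact Submodule.add_mem _ hx hy
  | smul c x _ hx =>
    rw [mul_smul_comm]
    exact Submodule.smul_mem _ c hx

theorem coeff_zero_creationSeries (η : ℂ) : PowerSeries.coeff 0 (creationSeries η) = 0 := by
  simp [creationSeries]

theorem coeff_succ_creationSeries_apply (η : ℂ) (k : ℕ) (v : FockSpace) :
    PowerSeries.coeff (k + 1) (creationSeries η) v =
      (η / ((k + 1 : ℕ) : ℂ)) • (MvPolynomial.X k * v) := by
  rw [creationSeries, PowerSeries.coeff_mk, if_neg (Nat.succ_ne_zero k)]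
  rfl

theorem creationSeries_pow_weightLE (η : ℂ) (r l : ℕ) {w : ℤ} {v : FockSpace}
    (hv : v ∈ weightLE w) :
    PowerSeries.coeff l (creationSeries η ^ r) v ∈ weightLE (w + l) := by
  induction r generalizing l with
  | zero =>
    rw [pow_zero, PowerSeries.coeff_one]
    split_ifs with h
    · simpa [h] using hv
    · simp
  | succ r ih =>
    rw [pow_succ', PowerSeries.coeff_mul, LinearMap.sum_apply]
    refine Submodule.sum_mem _ fun q hq => ?_
    obtain ⟨p, q⟩ := q
    rw [Finset.HasAntidiagonal.mem_antidiagonal] at hq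
    rw [Module.End.mul_apply]
    cases p with
    | zero => simp [coeff_zero_creationSeries]
    | succ k =>
      simp only at hq
      rw [coeff_succ_creationSeries_apply]
      have h := X_mul_weightLE k (ih q)
      have h2 : w + (l : ℤ) = w + q + (k + 1) := by omega
      rw [h2]
      exact Submodule.smul_mem _ _ h

/-! ### Generating the Fock space from one vertex operator. -/

theorem coeff_zero_expSeries {A : Type*} [Ring A] [Algebra ℂ A] (f : A⟦X⟧) :
    PowerSeries.coeff 0 (expSeries f) = 1 := by
  simp [expSeries]

/-- If `X i * v'` lies in `S` for all `i < k` and all `v'` of the appropriate weight, then so do the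
contributions of degree at least two in the creation operators to the coefficient of `z ^ (k + 1)`
in the exponential of the creation series. -/
theorem coeff_creationSeries_pow_mem (η : ℂ) (S : Submodule ℂ FockSpace) (w : ℤ) (k r : ℕ)
    (hS : ∀ i < k, ∀ u ∈ weightLE (w - (i + 1)), MvPolynomial.X i * u ∈ S)
    {u : FockSpace} (hu : u ∈ weightLE (w - (k + 1))) :
    PowerSeries.coeff (k + 1) (creationSeries η ^ (r + 2)) u ∈ S := by
  rw [pow_succ', PowerSeries.coeff_mul, LinearMap.sum_apply]
  refine Submodule.sum_mem _ fun q hq => ?_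
  obtain ⟨p, q⟩ := q
  rw [Finset.HasAntidiagonal.mem_antidiagonal] at hq
  simp only at hq
  rw [Module.End.mul_apply]
  cases p with
  | zero => simp [coeff_zero_creationSeries]
  | succ i =>
    rw [coeff_succ_creationSeries_apply]
    refine Submodule.smul_mem _ _ ?_
    rcases Nat.eq_zero_or_pos q with rfl | hq0
    -- A positive power of the creation series has no constant term; hence only `q ≥ 1`, that is `i
    -- < k`, contributes.
    · simp [coeff_zero_creationSeries, pow_succ', PowerSeries.coeff_mul]
    · refine hS i (by omega) _ ?_
      have h := creationSeries_pow_weightLE η (r + 1) q hu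
      have h2 : w - ((i : ℤ) + 1) = w - (k + 1) + q := by omega
      rw [h2]
      exact h

/-- Creation operators are recovered from the coefficients of the exponential of the creation
series. -/
theorem X_mul_mem_of_creationExp_mem {η : ℂ} (hη : η ≠ 0) (S : Submodule ℂ FockSpace) (w : ℤ)
    (hS : ∀ w' < w, ∀ u ∈ weightLE w', ∀ m,
      PowerSeries.coeff m (expSeries (creationSeries η)) u ∈ S) (k : ℕ) :
    ∀ u ∈ weightLE (w - (k + 1)), MvPolynomial.X k * u ∈ S := by
  induction k using Nat.strong_induction_on with
  | _ k ih =>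
    intro u hu
    have h := hS _ (by omega) u hu (k + 1)
    -- Splits off `r = 1`, the wanted multiple of `X k * u`, and `r = 0`, which vanishes in degree
    -- `k + 1`.
    rw [expSeries, PowerSeries.coeff_mk, LinearMap.sum_apply, Finset.sum_range_succ',
      Finset.sum_range_succ'] at h
    have hsum : ∑ r ∈ Finset.range k, ((((r + 1 + 1).factorial : ℂ)⁻¹) •
        PowerSeries.coeff (k + 1) (creationSeries η ^ (r + 1 + 1))) u ∈ S :=
      Submodule.sum_mem _ fun r _ =>
        Submodule.smul_mem _ _ (coeff_creationSeries_pow_mem η S w k r ih hu)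
    rw [add_assoc, Submodule.add_mem_iff_right _ hsum] at h
    simp only [zero_add, Nat.factorial_one, Nat.cast_one, inv_one, pow_one, one_smul,
      Nat.factorial_zero, pow_zero, PowerSeries.coeff_one, Nat.succ_ne_zero, if_false,
      LinearMap.zero_apply, add_zero, coeff_succ_creationSeries_apply] at h
    refine (Submodule.smul_mem_iff _ (div_ne_zero hη ?_)).1 h
    exact_mod_cast Nat.succ_ne_zero k

/-- Every nonconstant monomial is some `X k` times a monomial of weight smaller by `k + 1`. -/
theorem weightLE_le_of_X_mul_mem (S : Submodule ℂ FockSpace) (h1 : 1 ∈ S) (w : ℤ)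
    (hS : ∀ k : ℕ, ∀ u ∈ weightLE (w - (k + 1)), MvPolynomial.X k * u ∈ S) :
    weightLE w ≤ S := by
  rw [weightLE, MvPolynomial.restrictSupport_eq_span, Submodule.span_le]
  rintro _ ⟨m, hm, rfl⟩
  simp only [Set.mem_ofPred_eq] at hm
  rcases eq_or_ne m 0 with rfl | hm0
  · exact h1
  · obtain ⟨k, hk⟩ := Finsupp.ne_iff.1 hm0
    rw [Finsupp.zero_apply] at hk
    have hle : Finsupp.single k 1 ≤ m := by
      rw [Finsupp.single_le_iff]
      omega
    have h2 := congrArg (Finsupp.weight fun k : ℕ => k + 1) (tsub_add_cancel_of_le hle)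
    rw [map_add, Finsupp.weight_single] at h2
    simp only [smul_eq_mul, one_mul] at h2
    have h3 := hS k (MvPolynomial.monomial (m - Finsupp.single k 1) 1) (by
      rw [weightLE, MvPolynomial.monomial_mem_restrictSupport]
      left
      simp only [Set.mem_ofPred_eq]
      omega)
    rw [MvPolynomial.X, MvPolynomial.monomial_mul, mul_one, add_comm,
      tsub_add_cancel_of_le hle] at h3
    exact h3

/-- `expCoeff η m v` is the coefficient of the creation exponential applied to `v`, plus terms
that involve vectors of smaller weight. -/
theorem creationExp_mem_of_expCoeff_mem (η : ℂ) (S : Submodule ℂ FockSpace) (w : ℤ)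
    (hS : ∀ w' < w, ∀ u ∈ weightLE w', ∀ m,
      PowerSeries.coeff m (expSeries (creationSeries η)) u ∈ S)
    {v : FockSpace} (hv : v ∈ weightLE w) (m : ℕ) (hm : expCoeff η m v ∈ S) :
    PowerSeries.coeff m (expSeries (creationSeries η)) v ∈ S := by
  obtain ⟨L, hL⟩ := annihilationExp_eventually_zero η v
  have hterm (l : ℕ) : expTerm η m l v = PowerSeries.coeff (m + l) (expSeries (creationSeries η))
      (PowerSeries.coeff l (expSeries (annihilationSeries η)) v) := by
    rw [expTerm, if_pos (by omega), Module.End.mul_apply]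
    rfl
  have hsum : expCoeff η m v = ∑ l ∈ Finset.range (L + 1), expTerm η m l v := by
    refine finsum_eq_sum_of_support_subset _ fun l hl => ?_
    rw [Finset.coe_range, Set.mem_Iio]
    by_contra h
    exact hl (by simp only [hterm]; rw [hL l (by omega), map_zero])
  -- The term `l = 0` is the creation coefficient itself; for `l ≥ 1` the annihilation factor
  -- strictly lowers the weight.
  rw [hsum, Finset.sum_range_succ', Submodule.add_mem_iff_right, hterm, coeff_zero_expSeries,
    add_zero, Module.End.one_apply] at hm
  · exact hm
  · refine Submodule.sum_mem _ fun l _ => ?_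
    rw [hterm]
    exact hS _ (by omega) _ (annihilationExp_weightLE η (l + 1) w hv) _

/-- A subspace of the Fock space that contains the vacuum and is stable under the modes of a
vertex operator of nonzero charge is the whole space. -/
theorem eq_top_of_expCoeff_mem {η : ℂ} (hη : η ≠ 0) (S : Submodule ℂ FockSpace) (h1 : 1 ∈ S)
    (hS : ∀ p, ∀ v ∈ S, expCoeff η p v ∈ S) : S = ⊤ := by
  -- Both claims must be carried together: membership in weight `w` uses the creation coefficients
  -- in lower weights, and in turn gives those in weight `w`. The base case is negative weight,
  -- where `v = 0`.
  have key (n : ℕ) : ∀ w : ℤ, w < n → ∀ v ∈ weightLE w, v ∈ S ∧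
      ∀ m, PowerSeries.coeff m (expSeries (creationSeries η)) v ∈ S := by
    induction n with
    | zero =>
      intro w hw v hv
      rw [weightLE_neg hw hv]
      simp
    | succ n ih =>
      intro w hw v hv
      have hlt : ∀ w' < w, ∀ u ∈ weightLE w', ∀ m,
          PowerSeries.coeff m (expSeries (creationSeries η)) u ∈ S :=
        fun w' hw' u hu => (ih w' (by omega) u hu).2
      have hvS : v ∈ S :=
        weightLE_le_of_X_mul_mem S h1 w (X_mul_mem_of_creationExp_mem hη S w hlt) hv
      exact ⟨hvS, fun m => creationExp_mem_of_expCoeff_mem η S w hlt hv m (hS m v hvS)⟩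
  refine eq_top_iff.2 fun v _ => ?_
  obtain ⟨w, hw⟩ := exists_weightLE v
  exact (key (w + 1) w (by omega) v hw).1

theorem expCoeff_zero_one (η : ℂ) : expCoeff η 0 1 = 1 := by
  have h1 : (1 : FockSpace) ∈ weightLE 0 := by
    rw [weightLE, ← MvPolynomial.C_1, ← MvPolynomial.monomial_zero',
      MvPolynomial.monomial_mem_restrictSupport]
    left
    simp
  change ∑ᶠ l : ℕ, expTerm η 0 l 1 = 1
  rw [finsum_eq_single _ 0]
  · simp [expTerm, coeff_zero_expSeries]
  · intro l hl
    rw [expTerm, if_pos (by omega), Module.End.mul_apply,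
      weightLE_neg (by omega) (annihilationExp_weightLE η l 0 h1), map_zero]

/-! ### Basic subspaces of the lattice space. -/

theorem vertexCoeff_single (M : ℕ) (k p j : ℤ) (x : FockSpace) :
    vertexCoeff M k p (Finsupp.single j x) =
      Finsupp.single (j + k) (expCoeff (charge M k) (p - k * j * M) x) := by
  simp [vertexCoeff]

/-- The vectors obtained from `|j√M⟩` by applying polynomials in the modes of `V_{√M}(z)`. -/
noncomputable def basicSubspace (M : ℕ) (j : ℤ) : Submodule ℂ (LatticeSpace M) :=
  (Subalgebra.toSubmodule (Algebra.adjoin ℂ (Set.range (vertexCoeff M 1)))).map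
    (LinearMap.applyₗ (vac M j))

theorem mem_basicSubspace {M : ℕ} {j : ℤ} {v : LatticeSpace M} :
    v ∈ basicSubspace M j ↔
      ∃ P ∈ Algebra.adjoin ℂ (Set.range (vertexCoeff M 1)), P (vac M j) = v :=
  Iff.rfl

theorem vac_mem_basicSubspace (M : ℕ) (j : ℤ) : vac M j ∈ basicSubspace M j :=
  mem_basicSubspace.2 ⟨1, one_mem _, rfl⟩

theorem vertexCoeff_mem_basicSubspace {M : ℕ} {j : ℤ} (p : ℤ) {v : LatticeSpace M}
    (hv : v ∈ basicSubspace M j) : vertexCoeff M 1 p v ∈ basicSubspace M j := by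
  obtain ⟨P, hP, rfl⟩ := mem_basicSubspace.1 hv
  exact mem_basicSubspace.2
    ⟨vertexCoeff M 1 p * P, mul_mem (Algebra.subset_adjoin ⟨p, rfl⟩) hP, rfl⟩

theorem vertexCoeff_vac (M : ℕ) (j : ℤ) : vertexCoeff M 1 (j * M) (vac M j) = vac M (j + 1) := by
  rw [vac, vertexCoeff_single, one_mul, sub_self, expCoeff_zero_one]
  rfl

theorem basicSubspace_antitone (M : ℕ) : Antitone (basicSubspace M) := by
  refine antitone_int_of_succ_le fun j v hv => ?_
  obtain ⟨P, hP, rfl⟩ := mem_basicSubspace.1 hv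
  refine mem_basicSubspace.2 ⟨P * vertexCoeff M 1 (j * M),
    mul_mem hP (Algebra.subset_adjoin ⟨_, rfl⟩), ?_⟩
  rw [Module.End.mul_apply, vertexCoeff_vac]

theorem charge_one_ne_zero {M : ℕ} (hM : M ≠ 0) : charge M 1 ≠ 0 := by
  rw [charge, Complex.ofReal_ne_zero, Int.cast_one, one_mul, Real.sqrt_ne_zero']
  exact_mod_cast Nat.pos_of_ne_zero hM

theorem iUnion_basicSubspace {M : ℕ} (hM : M ≠ 0) :
    ⋃ j, (basicSubspace M j : Set (LatticeSpace M)) = Set.univ := by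
  have hdir : Directed (· ≤ ·) (basicSubspace M) := (basicSubspace_antitone M).directed_le
  have hmem (v : LatticeSpace M) :
      v ∈ ⨆ j, basicSubspace M j ↔ ∃ j, v ∈ basicSubspace M j :=
    Submodule.mem_iSup_of_directed _ hdir
  -- A mode shifts the charge index by one, so only the intersection over all `j` is visibly stable.
  have hcomap : (⨅ j, (⨆ i, basicSubspace M i).comap (Finsupp.lsingle j) :
      Submodule ℂ FockSpace) = ⊤ := by
    refine eq_top_of_expCoeff_mem (charge_one_ne_zero hM) _ ?_ fun p v hv => ?_
    · refine Submodule.mem_iInf _ |>.2 fun j => ?_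
      exact (hmem _).2 ⟨j, vac_mem_basicSubspace M j⟩
    · refine Submodule.mem_iInf _ |>.2 fun j => ?_
      obtain ⟨i, hi⟩ := (hmem _).1 ((Submodule.mem_iInf _).1 hv (j - 1))
      -- The shift `(j - 1) * M` cancels the power of z coming from z^{η a_0} on the component `j -
      -- 1`.
      have h := vertexCoeff_mem_basicSubspace (p + (j - 1) * M) hi
      rw [Finsupp.lsingle_apply, vertexCoeff_single, one_mul, add_sub_cancel_right,
        sub_add_cancel] at h
      exact (hmem _).2 ⟨i, h⟩
  refine Set.eq_univ_of_forall fun v => Set.mem_iUnion.2 ((hmem v).1 ?_)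
  induction v using Finsupp.induction_linear with
  | zero => exact zero_mem _
  | add u v hu hv => exact add_mem hu hv
  | single j x =>
    have hx : x ∈ (⨅ j, (⨆ i, basicSubspace M i).comap (Finsupp.lsingle j) :
        Submodule ℂ FockSpace) := hcomap ▸ Submodule.mem_top
    exact (Submodule.mem_iInf _).1 hx j

/-! ### Even and odd cases: the modes only differ by reindexing. -/

theorem coeff_V (M : ℕ) (k p : ℤ) : HVertexOperator.coeff (V M k) p = vertexCoeff M k p := by
  ext1 v
  simp [V]

theorem range_e (N : ℕ) : Set.range (e N) = Set.range (vertexCoeff (2 * N) 1) := by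
  have h : e N = vertexCoeff (2 * N) 1 ∘ fun n => -n - N := funext fun n => coeff_V _ _ _
  rw [h, Function.Surjective.range_comp]
  exact fun p => ⟨-p - N, by ring⟩

theorem range_θ (N : ℕ) : Set.range (θ N) = Set.range (vertexCoeff (2 * N + 1) 1) := by
  have h : θ N = vertexCoeff (2 * N + 1) 1 ∘ fun n => -n := funext fun n => coeff_V _ _ _
  rw [h, Function.Surjective.range_comp]
  exact neg_surjective

theorem evenUnion_eq_univ {N : ℕ} (hN : 1 ≤ N) : evenUnion N = Set.univ := by
  simp only [evenUnion, evenBasic, range_e]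
  exact iUnion_basicSubspace (by omega)

theorem oddUnion_eq_univ (N : ℕ) : oddUnion N = Set.univ := by
  simp only [oddUnion, oddBasic, range_θ]
  exact iUnion_basicSubspace (by omega)

end LatticeVOA

theorem mainTheorem3 (N : ℕ) :
    (1 ≤ N →
      (∀ n : ℤ, ∀ v ∈ LatticeVOA.evenUnion N, LatticeVOA.a (2 * N) n v ∈ LatticeVOA.evenUnion N) ∧
        LatticeVOA.evenUnion N = Set.univ) ∧
    ((∀ n : ℤ, ∀ v ∈ LatticeVOA.oddUnion N, LatticeVOA.a (2 * N + 1) n v ∈ LatticeVOA.oddUnion N) ∧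
      LatticeVOA.oddUnion N = Set.univ) := by
  refine ⟨fun hN => ?_, ?_⟩
  · rw [LatticeVOA.evenUnion_eq_univ hN]
    exact ⟨fun _ _ _ => Set.mem_univ _, rfl⟩
  · rw [LatticeVOA.oddUnion_eq_univ N]
    exact ⟨fun _ _ _ => Set.mem_univ _, rfl⟩
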